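/- Let $n\ge 2$, let $M_*$ be an $n$-dimensional manifold (of class $C^3$, or smoother) with a pseudo-Riemannian metric $g_*$ of arbitrary signature (of class $C^2$, or smoother), and let $\varphi: M_*\to\mathbb{R}$ be a nowhere vanishing function of class $C^2$. Let $\varepsilon\in\{1,-1\}$, equip the $(n+1)$-dimensional manifold $M=\mathbb{R}\times M_*$ with the product metric $g=\varepsilon\,dt^2+g_*$, and put $\overline g=\varphi^{-2}g$, where $\varphi$ is regarded as a function on $M$ that does not depend on $t$. Denote by $\mathrm{Ric}_*$, $S_*$, $\nabla_*^2$, $\Delta_*=\mathrm{trace}_{g_*}\nabla_*^2$ the Ricci tensor, scalar curvature, Hessian and Laplacian of $g_*$, by $\|\mathrm{grad}\,\varphi\|^2=g_*(\mathrm{grad}\,\varphi,\mathrm{grad}\,\varphi)$ the squared norm of the $g_*$-gradient, and let $k_*=S_*/(n(n-1))$ and $\overline S/((n+1)n)$ be the normalized scalar curvatures of $g_*$ and of $\overline g$. A metric is called Einstein if its Ricci tensor equals $\lambda$ times the metric for a constant $\lambda$. Then $\overline g$ is an Einstein metric if and only if the two equations $$\varphi\cdot \mathrm{Ric}_*+(n-1)\,\nabla_*^2\varphi=0,\qquad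 \|\mathrm{grad}\,\varphi\|^2+\varphi^2k_*+\overline k=0$$ hold on $M_*$ with some constant $\overline k\in\mathbb{R}$. If $\overline g$ is Einstein, then the second equation holds with $\overline k$ the normalized scalar curvature of $\overline g$. The $g_*$-trace of the left-hand side of the first equation is $\varphi S_*+(n-1)\Delta_*\varphi$, so the first equation implies $$\varphi\,S_*+(n-1)\,\Delta_*\varphi=0 .$$ -/

import Mathlib

set_option maxSynthPendingDepth 3

open scoped Manifold ContDiff

noncomputable section

namespace PseudoRiem

/-! ### Curvature of a bilinear-form-valued function on a vector space (one coordinate patch) -/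

section Coord

variable {E : Type*} [NormedAddCommGroup E] [NormedSpace ℝ E]

/-- The cyclic permutation `(v, w, z) ↦ A(z, v, w)` of a trilinear form `A`. -/
def rotateForm (A : E →L[ℝ] E →L[ℝ] E →L[ℝ] ℝ) : E →L[ℝ] E →L[ℝ] E →L[ℝ] ℝ :=
  (ContinuousLinearMap.flipₗᵢ ℝ E E ℝ).toContinuousLinearEquiv.toContinuousLinearMap ∘L A.flip

theorem rotateForm_apply (A : E →L[ℝ] E →L[ℝ] E →L[ℝ] ℝ) (v w z : E) :
    rotateForm A v w z = A z v w := rfl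

/-- The right-hand side of the coordinate Koszul formula,
`K(v, w)(z) = (1/2) (D_v G (w, z) + D_w G (v, z) - D_z G (v, w))`,
that is, the Christoffel symbols of the first kind of `G` at `y`. -/
def christoffelFirst (G : E → E →L[ℝ] E →L[ℝ] ℝ) (y : E) : E →L[ℝ] E →L[ℝ] E →L[ℝ] ℝ :=
  (1 / 2 : ℝ) • (fderiv ℝ G y + (fderiv ℝ G y).flip - rotateForm (fderiv ℝ G y))

theorem christoffelFirst_apply (G : E → E →L[ℝ] E →L[ℝ] ℝ) (y v w z : E) :
    christoffelFirst G y v w z =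
      1 / 2 * (fderiv ℝ G y v w z + fderiv ℝ G y w v z - fderiv ℝ G y z v w) := by
  simp [christoffelFirst, rotateForm_apply]

/-- The Christoffel symbols of the second kind: `Γ(v, w)` is the vector with
`G(Γ(v, w), z) = K(v, w)(z)` for all `z`. -/
def christoffel (G : E → E →L[ℝ] E →L[ℝ] ℝ) (y : E) : E →L[ℝ] E →L[ℝ] E :=
  ContinuousLinearMap.compL ℝ E (E →L[ℝ] ℝ) E (G y).inverse ∘L christoffelFirst G y

theorem christoffel_apply (G : E → E →L[ℝ] E →L[ℝ] ℝ) (y v w : E) :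
    christoffel G y v w = (G y).inverse (christoffelFirst G y v w) := rfl

/-- The endomorphism `V ↦ R(V, X) Y` of the curvature tensor
`R(X, Y) Z = ∇_X ∇_Y Z - ∇_Y ∇_X Z - ∇_[X, Y] Z`, in coordinates. -/
def curvatureEndo (G : E → E →L[ℝ] E →L[ℝ] ℝ) (y X Y : E) : E →L[ℝ] E :=
  ((fderiv ℝ (christoffel G) y).flip X).flip Y - (fderiv ℝ (christoffel G) y X).flip Y
    + (christoffel G y).flip (christoffel G y X Y)
    - (christoffel G y X) ∘L ((christoffel G y).flip Y)

theorem curvatureEndo_apply (G : E → E →L[ℝ] E →L[ℝ] ℝ) (y X Y V : E) :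
    curvatureEndo G y X Y V =
      fderiv ℝ (christoffel G) y V X Y - fderiv ℝ (christoffel G) y X V Y
        + christoffel G y V (christoffel G y X Y) - christoffel G y X (christoffel G y V Y) := rfl

/-- The Hessian `∇²F(X, Y) = D²F(X, Y) - dF(Γ(X, Y))` in coordinates. -/
def coordHessian (G : E → E →L[ℝ] E →L[ℝ] ℝ) (F : E → ℝ) (y : E) : E →L[ℝ] E →L[ℝ] ℝ :=
  fderiv ℝ (fderiv ℝ F) y -
    ContinuousLinearMap.compL ℝ E E ℝ (fderiv ℝ F y) ∘L christoffel G y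

variable [FiniteDimensional ℝ E]

/-- The Ricci tensor `Ric(X, Y) = trace (V ↦ R(V, X) Y)` in coordinates. -/
def coordRicci (G : E → E →L[ℝ] E →L[ℝ] ℝ) (y : E) : E →L[ℝ] E →L[ℝ] ℝ :=
  LinearMap.toContinuousLinearMap (LinearMap.toContinuousLinearMap.toLinearMap ∘ₗ
    LinearMap.mk₂ ℝ (fun X Y => LinearMap.trace ℝ E (curvatureEndo G y X Y).toLinearMap)
      (fun X X' Y => by
        rw [← map_add]; congr 1; ext V; simp [curvatureEndo_apply]; abel)
      (fun c X Y => by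
        rw [← map_smul]; congr 1; ext V; simp [curvatureEndo_apply, smul_sub, smul_add])
      (fun X Y Y' => by
        rw [← map_add]; congr 1; ext V; simp [curvatureEndo_apply]; abel)
      (fun c X Y => by
        rw [← map_smul]; congr 1; ext V; simp [curvatureEndo_apply, smul_sub, smul_add]))

theorem coordRicci_apply (G : E → E →L[ℝ] E →L[ℝ] ℝ) (y X Y : E) :
    coordRicci G y X Y = LinearMap.trace ℝ E (curvatureEndo G y X Y).toLinearMap := rfl

end Coord

/-! ### Linear algebra of bilinear forms -/

section Algebra

variable {V W : Type*} [AddCommGroup V] [Module ℝ V] [TopologicalSpace V]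
  [AddCommGroup W] [Module ℝ W] [TopologicalSpace W]

/-- The pull-back `(v, w) ↦ B(L v, L w)` of a bilinear form. -/
def pullForm (B : W →L[ℝ] W →L[ℝ] ℝ) (L : V →L[ℝ] W) : V →L[ℝ] V →L[ℝ] ℝ :=
  ContinuousLinearMap.precomp ℝ L ∘L (B ∘L L)

theorem pullForm_apply (B : W →L[ℝ] W →L[ℝ] ℝ) (L : V →L[ℝ] W) (v w : V) :
    pullForm B L v w = B (L v) (L w) := rfl

/-- The trace of the bilinear form `B` with respect to the nondegenerate symmetric form `b`, i.e.
the trace of the endomorphism `A` with `b(A v, w) = B(v, w)`. -/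
def metricTrace (b B : V →L[ℝ] V →L[ℝ] ℝ) : ℝ :=
  LinearMap.trace ℝ V (b.inverse ∘L B).toLinearMap

end Algebra

/-! ### Pseudo-Riemannian manifolds -/

section Manifold

variable {E : Type*} [NormedAddCommGroup E] [NormedSpace ℝ E]
  {H : Type*} [TopologicalSpace H] (I : ModelWithCorners ℝ E H)
  {M : Type*} [TopologicalSpace M] [ChartedSpace H M]

/-- A field of bilinear forms on the tangent spaces of `M`: a `(0,2)`-tensor field. -/
abbrev FormField (M : Type*) [TopologicalSpace M] [ChartedSpace H M] : Type _ :=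
  ∀ x : M, TangentSpace I x →L[ℝ] TangentSpace I x →L[ℝ] ℝ

variable {I}

/-- The expression of a `(0,2)`-tensor field in the chart at `x₀`: the pull-back of the field along
the inverse of this chart. -/
def localForm (g : FormField I M) (x₀ : M) (y : E) : E →L[ℝ] E →L[ℝ] ℝ :=
  pullForm (V := E) (g ((extChartAt I x₀).symm y))
    (mfderiv 𝓘(ℝ, E) I (extChartAt I x₀).symm y)

/-- `g` is a pseudo-Riemannian metric of class `C^k`: symmetric, nondegenerate, of arbitrary
signature, with components of class `C^k` in the charts. -/
structure IsPseudoRiemannianMetric (k : WithTop ℕ∞) (g : FormField I M) : Prop where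
  symm : ∀ (x : M) (v w : TangentSpace I x), g x v w = g x w v
  nondegenerate : ∀ (x : M) (v : TangentSpace I x),
    (∀ w : TangentSpace I x, g x v w = 0) → v = 0
  contDiffOn : ∀ x₀ : M, ContDiffOn ℝ k (localForm g x₀) (extChartAt I x₀).target

/-- The gradient of `f`: the vector with `g(grad f, w) = df(w)` for all `w`. -/
def gradient (g : FormField I M) (f : M → ℝ) (x : M) : TangentSpace I x :=
  (g x).inverse (mfderiv I 𝓘(ℝ, ℝ) f x)

/-- `‖grad f‖² = g(grad f, grad f)`, which may be negative or zero for indefinite `g`. -/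
def gradNormSq (g : FormField I M) (f : M → ℝ) (x : M) : ℝ :=
  g x (gradient g f x) (gradient g f x)

/-- The Hessian `∇²f`, computed in the chart at `x` and transported to `T_x M`. -/
def hessian (g : FormField I M) (f : M → ℝ) : FormField I M := fun x =>
  pullForm (W := E)
    (coordHessian (localForm g x) (f ∘ (extChartAt I x).symm) (extChartAt I x x))
    (mfderiv I 𝓘(ℝ, E) (extChartAt I x) x)

/-- The Laplacian `Δf`, the trace of the Hessian. -/
def laplacian (g : FormField I M) (f : M → ℝ) (x : M) : ℝ :=
  metricTrace (g x) (hessian g f x)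

/-- The metric `ψ · g` for a function `ψ`. -/
def scaleForm (ψ : M → ℝ) (g : FormField I M) : FormField I M := fun x => ψ x • g x

/-- The metric `ε dt²` on the real line. -/
def lineMetric (ε : ℝ) : FormField 𝓘(ℝ, ℝ) ℝ := fun _ => ε • ContinuousLinearMap.mul ℝ ℝ

variable {E' : Type*} [NormedAddCommGroup E'] [NormedSpace ℝ E']
  {H' : Type*} [TopologicalSpace H'] {I' : ModelWithCorners ℝ E' H'}
  {M' : Type*} [TopologicalSpace M'] [ChartedSpace H' M']

/-- The product metric `g + g'` on `M × M'`, the sum of the pull-backs along the projections. -/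
def productMetric (g : FormField I M) (g' : FormField I' M') :
    FormField (I.prod I') (M × M') := fun p =>
  pullForm (g p.1) (mfderiv (I.prod I') I Prod.fst p) +
    pullForm (g' p.2) (mfderiv (I.prod I') I' Prod.snd p)

variable [FiniteDimensional ℝ E]

/-- The Ricci tensor, computed in the chart at `x` and transported to `T_x M`. -/
def ricci (g : FormField I M) : FormField I M := fun x =>
  pullForm (W := E)
    (coordRicci (localForm g x) (extChartAt I x x))
    (mfderiv I 𝓘(ℝ, E) (extChartAt I x) x)

/-- The scalar curvature `S`, the trace of the Ricci tensor. -/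
def scalarCurvature (g : FormField I M) (x : M) : ℝ := metricTrace (g x) (ricci g x)

/-- The normalized scalar curvature `k = S / (d (d - 1))` in dimension `d`. -/
def normalizedScalarCurvature (g : FormField I M) (x : M) : ℝ :=
  scalarCurvature g x / ((Module.finrank ℝ E : ℝ) * ((Module.finrank ℝ E : ℝ) - 1))

/-- `g` is an Einstein metric: `Ric = lam • g` for a constant `lam`. -/
def IsEinstein (g : FormField I M) : Prop :=
  ∃ lam : ℝ, ∀ x : M, ricci g x = lam • g x

end Manifold

end PseudoRiem

end

/-! Everything follows from one formula. For a metric `G` in dimension `d`, the Ricci tensor of `F⁻²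
G` is `Ric + F⁻¹ ((d - 2) ∇²F + ΔF · G) - (d - 1) F⁻² ‖grad F‖² G` (`coordRicci_conformal`). Take `d
= n + 1` and `G = ε dt² + g`. The line factor is flat and `φ` does not depend on `t`, so the Ricci
tensor, Hessian, gradient and Laplacian all come from the factor `M`. Hence `Ric(gbar) = φ⁻¹ T + μ
gbar`, where `T = φ Ric + (n - 1) ∇²φ` involves only directions tangent to `M`, and `μ = φ Δφ - n
‖grad φ‖²` (`ricci_conformal_product`).

Since `T` is blind to `∂_t` while `gbar(∂_t, ∂_t) ≠ 0`, the equation `Ric(gbar) = lam gbar` splits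
into `T = 0` and `μ = lam` (`eq_smul_iff_of_line_product`). Tracing `T = 0` expresses `Δφ` through
the scalar curvature and turns `μ` into `-n (‖grad φ‖² + φ² k)`. So `μ` is constant exactly when the
second equation holds, with `kbar = lam / n`. Tracing the Einstein equation itself shows that `lam /
n` is the normalized scalar curvature of `gbar`.

The curvature computations take place in a vector space. They transfer to the manifold because the
product chart at `(t, x)` is the identity times the chart at `x` (`localForm_conformal_product`). -/

noncomputable section

namespace PseudoRiem

open Topology Filter

/-! ### Levi-Civita connection and regularity in coordinates -/

section CoordCalculus

variable {E : Type*} [NormedAddCommGroup E] [NormedSpace ℝ E]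

/-- The derivative of a field of bilinear maps, evaluated at fixed vectors. -/
theorem fderiv_bilin_apply {F : Type*} [NormedAddCommGroup F] [NormedSpace ℝ F]
    {T : E → E →L[ℝ] E →L[ℝ] F} {y : E} (hT : DifferentiableAt ℝ T y) (V X Y : E) :
    fderiv ℝ (fun z => T z X Y) y V = fderiv ℝ T y V X Y := by
  have h1 : HasFDerivAt (fun z => T z X Y) _ y :=
    (hT.hasFDerivAt.clm_apply (hasFDerivAt_const X y)).clm_apply (hasFDerivAt_const Y y)
  rw [h1.fderiv]
  simp

theorem fderiv_form_symm {G : E → E →L[ℝ] E →L[ℝ] ℝ} {y : E} (hG : DifferentiableAt ℝ G y)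
    (hs : ∀ᶠ z in 𝓝 y, ∀ v w, G z v w = G z w v) (V X Y : E) :
    fderiv ℝ G y V X Y = fderiv ℝ G y V Y X := by
  rw [← fderiv_bilin_apply hG, ← fderiv_bilin_apply hG]
  have : (fun z => G z X Y) =ᶠ[𝓝 y] fun z => G z Y X := hs.mono fun z hz => hz X Y
  rw [this.fderiv_eq]

theorem christoffel_symm {G : E → E →L[ℝ] E →L[ℝ] ℝ} {y : E} (hG : DifferentiableAt ℝ G y)
    (hs : ∀ᶠ z in 𝓝 y, ∀ v w, G z v w = G z w v) (X Y : E) :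
    christoffel G y X Y = christoffel G y Y X := by
  rw [christoffel_apply, christoffel_apply]
  congr 1
  ext z
  rw [christoffelFirst_apply, christoffelFirst_apply, fderiv_form_symm hG hs z X Y]
  ring

theorem form_christoffel {G : E → E →L[ℝ] E →L[ℝ] ℝ} {y : E} (hi : (G y).IsInvertible)
    (X Y Z : E) : G y (christoffel G y X Y) Z =
      1 / 2 * (fderiv ℝ G y X Y Z + fderiv ℝ G y Y X Z - fderiv ℝ G y Z X Y) := by
  rw [christoffel_apply, hi.self_apply_inverse, christoffelFirst_apply]

/-- The Christoffel symbols define a connection for which `G` is parallel. -/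
theorem fderiv_form_eq {G : E → E →L[ℝ] E →L[ℝ] ℝ} {y : E} (hG : DifferentiableAt ℝ G y)
    (hi : (G y).IsInvertible) (hs : ∀ᶠ z in 𝓝 y, ∀ v w, G z v w = G z w v) (V X Y : E) :
    fderiv ℝ G y V X Y = G y (christoffel G y V X) Y + G y X (christoffel G y V Y) := by
  rw [hs.self_of_nhds X, form_christoffel hi, form_christoffel hi]
  rw [fderiv_form_symm hG hs V Y X, fderiv_form_symm hG hs X V Y, fderiv_form_symm hG hs Y V X]
  ring

theorem eventually_isInvertible [CompleteSpace E] {G : E → E →L[ℝ] E →L[ℝ] ℝ} {y : E}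
    (hG : ContinuousAt G y) (hi : (G y).IsInvertible) : ∀ᶠ z in 𝓝 y, (G z).IsInvertible := by
  obtain ⟨e, he⟩ := hi
  have h := ContinuousLinearEquiv.nhds e
  rw [he] at h
  filter_upwards [hG h] with z hz
  obtain ⟨e', he'⟩ := hz
  exact ⟨e', he'⟩

theorem differentiableAt_inverse [CompleteSpace E] {G : E → E →L[ℝ] E →L[ℝ] ℝ} {y : E}
    (hG : DifferentiableAt ℝ G y) (hi : (G y).IsInvertible) :
    DifferentiableAt ℝ (fun z => (G z).inverse) y :=
  ((hi.contDiffAt_map_inverse (n := 1)).differentiableAt one_ne_zero).comp y hG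

theorem differentiableAt_fderiv {F : Type*} [NormedAddCommGroup F] [NormedSpace ℝ F] {f : E → F}
    {y : E} (hf : ContDiffAt ℝ 2 f y) : DifferentiableAt ℝ (fderiv ℝ f) y :=
  (hf.fderiv_right (m := 1) (by norm_num)).differentiableAt one_ne_zero

theorem differentiableAt_christoffelFirst {G : E → E →L[ℝ] E →L[ℝ] ℝ} {y : E}
    (hG : ContDiffAt ℝ 2 G y) : DifferentiableAt ℝ (christoffelFirst G) y := by
  have h := differentiableAt_fderiv hG
  have hflip : DifferentiableAt ℝ (fun z => (fderiv ℝ G z).flip) y :=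
    (ContinuousLinearMap.flipₗᵢ ℝ E E (E →L[ℝ] ℝ)).toContinuousLinearEquiv.differentiableAt.comp
      y h
  have hrot : DifferentiableAt ℝ (fun z => rotateForm (fderiv ℝ G z)) y :=
    (differentiableAt_const _).clm_comp hflip
  exact ((h.add hflip).sub hrot).const_smul (1 / 2 : ℝ)

theorem differentiableAt_christoffel [CompleteSpace E] {G : E → E →L[ℝ] E →L[ℝ] ℝ} {y : E}
    (hG : ContDiffAt ℝ 2 G y) (hi : (G y).IsInvertible) :
    DifferentiableAt ℝ (christoffel G) y := by
  have h := differentiableAt_inverse (hG.differentiableAt two_ne_zero) hi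
  exact ((ContinuousLinearMap.differentiableAt _).comp y h).clm_comp
    (differentiableAt_christoffelFirst hG)

theorem christoffelFirst_congr {G G' : E → E →L[ℝ] E →L[ℝ] ℝ} {y : E} (h : G =ᶠ[𝓝 y] G') :
    christoffelFirst G y = christoffelFirst G' y := by
  rw [christoffelFirst, christoffelFirst, h.fderiv_eq]

theorem christoffel_congr {G G' : E → E →L[ℝ] E →L[ℝ] ℝ} {y : E} (h : G =ᶠ[𝓝 y] G') :
    christoffel G y = christoffel G' y := by
  rw [christoffel, christoffel, h.eq_of_nhds, christoffelFirst_congr h]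

/-- Ricci depends only on the germ of the metric, so a formula for the metric that is valid merely
near a point is enough. -/
theorem coordRicci_congr [FiniteDimensional ℝ E] {G G' : E → E →L[ℝ] E →L[ℝ] ℝ} {y : E}
    (h : G =ᶠ[𝓝 y] G') : coordRicci G y = coordRicci G' y := by
  have h1 : christoffel G =ᶠ[𝓝 y] christoffel G' :=
    h.eventuallyEq_nhds.mono fun z hz => christoffel_congr hz
  ext X Y
  rw [coordRicci_apply, coordRicci_apply]
  congr 2
  ext V
  rw [curvatureEndo_apply, curvatureEndo_apply, h1.fderiv_eq, h1.eq_of_nhds]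

theorem coordHessian_apply (G : E → E →L[ℝ] E →L[ℝ] ℝ) (F : E → ℝ) (y X Y : E) :
    coordHessian G F y X Y =
      fderiv ℝ (fderiv ℝ F) y X Y - fderiv ℝ F y (christoffel G y X Y) := rfl

end CoordCalculus

/-! ### Conformal change of the metric -/

section Conformal

variable {E : Type*} [NormedAddCommGroup E] [NormedSpace ℝ E]

/-- The coordinate gradient of `F` with respect to `G`. -/
def coordGradient (G : E → E →L[ℝ] E →L[ℝ] ℝ) (F : E → ℝ) (y : E) : E :=
  (G y).inverse (fderiv ℝ F y)

theorem form_coordGradient {G : E → E →L[ℝ] E →L[ℝ] ℝ} {y : E} (hi : (G y).IsInvertible)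
    (F : E → ℝ) (v : E) : G y (coordGradient G F y) v = fderiv ℝ F y v := by
  rw [coordGradient, hi.self_apply_inverse]

theorem form_injective {B : E →L[ℝ] E →L[ℝ] ℝ} (hi : B.IsInvertible) {v w : E}
    (h : ∀ z, B v z = B w z) : v = w :=
  hi.injective (ContinuousLinearMap.ext h)

theorem isInvertible_smul {B : E →L[ℝ] E →L[ℝ] ℝ} {c : ℝ} (hc : c ≠ 0) (hi : B.IsInvertible) :
    (c • B).IsInvertible := by
  obtain ⟨e, rfl⟩ := hi
  refine ⟨(ContinuousLinearEquiv.smulLeft (Units.mk0 c hc)).trans e, ?_⟩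
  ext v w
  simp [Units.smul_def]

/-- In the Koszul formula the derivative of `F⁻²` contributes three terms of the form `-2 F⁻³ dF ⊗
G`. Pairing both sides with the rescaled metric, which is invertible, identifies the vectors. -/
theorem christoffel_conformal {G : E → E →L[ℝ] E →L[ℝ] ℝ} {F : E → ℝ} {y : E}
    (hG : DifferentiableAt ℝ G y) (hi : (G y).IsInvertible)
    (hF : DifferentiableAt ℝ F y) (hF0 : F y ≠ 0) (X Y : E) :
    christoffel (fun z => (F z ^ 2)⁻¹ • G z) y X Y =
      christoffel G y X Y - (F y)⁻¹ • (fderiv ℝ F y X • Y + fderiv ℝ F y Y • X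
        - G y X Y • coordGradient G F y) := by
  have hψ : HasFDerivAt (fun z => (F z ^ 2)⁻¹) ((-(2 * (F y)⁻¹ ^ 3)) • fderiv ℝ F y) y := by
    have h := ((hasDerivAt_pow 2 (F y)).inv (pow_ne_zero 2 hF0)).comp_hasFDerivAt y hF.hasFDerivAt
    convert! h using 2
    field_simp
    norm_num
  have hi' : ((F y ^ 2)⁻¹ • G y).IsInvertible :=
    isInvertible_smul (inv_ne_zero (pow_ne_zero 2 hF0)) hi
  have hD : ∀ V X Y, fderiv ℝ (fun z => (F z ^ 2)⁻¹ • G z) y V X Y =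
      (F y ^ 2)⁻¹ * fderiv ℝ G y V X Y - 2 * (F y)⁻¹ ^ 3 * fderiv ℝ F y V * G y X Y := by
    intro V X Y
    have h : fderiv ℝ (fun z => (F z ^ 2)⁻¹ • G z) y = _ := (hψ.smul hG.hasFDerivAt).fderiv
    rw [h]
    simp
    ring
  refine form_injective hi' fun z => ?_
  rw [form_christoffel (G := fun z => (F z ^ 2)⁻¹ • G z) hi', hD, hD, hD]
  simp only [smul_apply, map_sub, map_add, map_smul,
    sub_apply, add_apply, smul_eq_mul,
    form_christoffel hi, form_coordGradient hi]
  field_simp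
  ring

theorem differentiableAt_coordGradient [CompleteSpace E] {G : E → E →L[ℝ] E →L[ℝ] ℝ} {F : E → ℝ}
    {y : E} (hG : DifferentiableAt ℝ G y) (hi : (G y).IsInvertible) (hF : ContDiffAt ℝ 2 F y) :
    DifferentiableAt ℝ (coordGradient G F) y :=
  (differentiableAt_inverse hG hi).clm_apply (differentiableAt_fderiv hF)

/-- This is `∇_V grad F = (∇²F(V, ·))♯`: differentiate `G(grad F, Z) = dF(Z)` along `V` and use that
`G` is parallel. -/
theorem fderiv_coordGradient [CompleteSpace E] {G : E → E →L[ℝ] E →L[ℝ] ℝ} {F : E → ℝ} {y : E}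
    (hG : DifferentiableAt ℝ G y) (hi : (G y).IsInvertible)
    (hs : ∀ᶠ z in 𝓝 y, ∀ v w, G z v w = G z w v) (hF : ContDiffAt ℝ 2 F y) (V : E) :
    fderiv ℝ (coordGradient G F) y V =
      (G y).inverse (coordHessian G F y V) - christoffel G y V (coordGradient G F y) := by
  refine form_injective hi fun Z => ?_
  have h1 : (fun z => G z (coordGradient G F z) Z) =ᶠ[𝓝 y] fun z => fderiv ℝ F z Z :=
    (eventually_isInvertible hG.continuousAt hi).mono fun z hz => form_coordGradient hz F Z
  have h2 := congrArg (fun L : E →L[ℝ] ℝ => L V) h1.fderiv_eq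
  have hl := (hG.hasFDerivAt.clm_apply
    (differentiableAt_coordGradient hG hi hF).hasFDerivAt).clm_apply (hasFDerivAt_const Z y)
  have hr := (differentiableAt_fderiv hF).hasFDerivAt.clm_apply (hasFDerivAt_const Z y)
  simp only [hl.fderiv, hr.fderiv] at h2
  simp at h2
  rw [fderiv_form_eq hG hi hs, form_coordGradient hi] at h2
  rw [map_sub, sub_apply, hi.self_apply_inverse, coordHessian_apply]
  linarith

theorem fderiv_christoffel_conformal [CompleteSpace E] {G : E → E →L[ℝ] E →L[ℝ] ℝ} {F : E → ℝ}
    {y : E} (hG : ContDiffAt ℝ 2 G y) (hi : (G y).IsInvertible)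
    (hs : ∀ᶠ z in 𝓝 y, ∀ v w, G z v w = G z w v) (hF : ContDiffAt ℝ 2 F y) (hF0 : F y ≠ 0)
    (V X Y : E) :
    fderiv ℝ (christoffel (fun z => (F z ^ 2)⁻¹ • G z)) y V X Y =
      fderiv ℝ (christoffel G) y V X Y
      + ((F y)⁻¹ ^ 2 * fderiv ℝ F y V) • (fderiv ℝ F y X • Y + fderiv ℝ F y Y • X
          - G y X Y • coordGradient G F y)
      - (F y)⁻¹ • (fderiv ℝ (fderiv ℝ F) y V X • Y + fderiv ℝ (fderiv ℝ F) y V Y • X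
          - (G y (christoffel G y V X) Y + G y X (christoffel G y V Y)) • coordGradient G F y
          - G y X Y • ((G y).inverse (coordHessian G F y V)
            - christoffel G y V (coordGradient G F y))) := by
  have hG1 : DifferentiableAt ℝ G y := hG.differentiableAt two_ne_zero
  have hF1 : DifferentiableAt ℝ F y := hF.differentiableAt two_ne_zero
  have hi' : ((F y ^ 2)⁻¹ • G y).IsInvertible :=
    isInvertible_smul (inv_ne_zero (pow_ne_zero 2 hF0)) hi
  have hG' : ContDiffAt ℝ 2 (fun z => (F z ^ 2)⁻¹ • G z) y :=
    ((hF.pow 2).inv (pow_ne_zero 2 hF0)).smul hG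
  -- The conformal formula is needed on a whole neighbourhood, since it is about to be
  -- differentiated.
  have hev : (fun z => christoffel (fun z => (F z ^ 2)⁻¹ • G z) z X Y) =ᶠ[𝓝 y] fun z =>
      christoffel G z X Y - (F z)⁻¹ • (fderiv ℝ F z X • Y + fderiv ℝ F z Y • X
        - G z X Y • coordGradient G F z) := by
    filter_upwards [eventually_isInvertible hG1.continuousAt hi,
      (hG.eventually (by simp)), (hF.eventually (by simp)),
      hF1.continuousAt.eventually_ne hF0] with z h1 h3 h4 h5
    exact christoffel_conformal (h3.differentiableAt two_ne_zero) h1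
      (h4.differentiableAt two_ne_zero) h5 X Y
  rw [← fderiv_bilin_apply (differentiableAt_christoffel hG' hi'), hev.fderiv_eq]
  have e1 := ((differentiableAt_christoffel hG hi).hasFDerivAt.clm_apply
    (hasFDerivAt_const X y)).clm_apply (hasFDerivAt_const Y y)
  have eG := (hG1.hasFDerivAt.clm_apply
    (hasFDerivAt_const X y)).clm_apply (hasFDerivAt_const Y y)
  have eF := fun Z : E => (differentiableAt_fderiv hF).hasFDerivAt.clm_apply (hasFDerivAt_const Z y)
  have eI := (hasDerivAt_inv hF0).comp_hasFDerivAt y hF1.hasFDerivAt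
  have eP := (differentiableAt_coordGradient hG1 hi hF).hasFDerivAt
  have e := e1.sub (eI.smul ((((eF X).smul_const Y).add ((eF Y).smul_const X)).sub (eG.smul eP)))
  have e' : fderiv ℝ (fun z => christoffel G z X Y - (F z)⁻¹ • (fderiv ℝ F z X • Y
      + fderiv ℝ F z Y • X - G z X Y • coordGradient G F z)) y = _ := e.fderiv
  rw [e']
  simp [fderiv_coordGradient hG1 hi hs hF, fderiv_form_eq hG1 hi hs]
  module

theorem curvatureEndo_conformal [CompleteSpace E] {G : E → E →L[ℝ] E →L[ℝ] ℝ} {F : E → ℝ}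
    {y : E} (hG : ContDiffAt ℝ 2 G y) (hi : (G y).IsInvertible)
    (hs : ∀ᶠ z in 𝓝 y, ∀ v w, G z v w = G z w v) (hF : ContDiffAt ℝ 2 F y) (hF0 : F y ≠ 0)
    (X Y V : E) :
    curvatureEndo (fun z => (F z ^ 2)⁻¹ • G z) y X Y V = curvatureEndo G y X Y V
      + (F y)⁻¹ • (coordHessian G F y X Y • V - coordHessian G F y V Y • X
          + G y X Y • (G y).inverse (coordHessian G F y V)
          - G y V Y • (G y).inverse (coordHessian G F y X))
      + ((F y)⁻¹ ^ 2 * fderiv ℝ F y (coordGradient G F y)) • (G y V Y • X - G y X Y • V) := by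
  have hG1 : DifferentiableAt ℝ G y := hG.differentiableAt two_ne_zero
  have hF1 : DifferentiableAt ℝ F y := hF.differentiableAt two_ne_zero
  have hP : ∀ v, G y v (coordGradient G F y) = fderiv ℝ F y v := fun v => by
    rw [hs.self_of_nhds, form_coordGradient hi]
  rw [curvatureEndo_apply, curvatureEndo_apply, fderiv_christoffel_conformal hG hi hs hF hF0,
    fderiv_christoffel_conformal hG hi hs hF hF0]
  simp only [christoffel_conformal hG1 hi hF1 hF0]
  simp only [map_sub, map_add, map_smul, coordHessian_apply, hP, smul_eq_mul]
  -- Symmetry of the connection, of `D²F` and of `G` cancels everything not present in the tensorial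
  -- formula.
  rw [christoffel_symm hG1 hs X V, (hF.isSymmSndFDerivAt (by simp)) X V,
    hs.self_of_nhds X V]
  module

theorem coordRicci_conformal [FiniteDimensional ℝ E] {G : E → E →L[ℝ] E →L[ℝ] ℝ} {F : E → ℝ}
    {y : E} (hG : ContDiffAt ℝ 2 G y) (hi : (G y).IsInvertible)
    (hs : ∀ᶠ z in 𝓝 y, ∀ v w, G z v w = G z w v) (hF : ContDiffAt ℝ 2 F y) (hF0 : F y ≠ 0)
    (X Y : E) :
    coordRicci (fun z => (F z ^ 2)⁻¹ • G z) y X Y = coordRicci G y X Y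
      + (F y)⁻¹ * (((Module.finrank ℝ E : ℝ) - 2) * coordHessian G F y X Y
          + metricTrace (G y) (coordHessian G F y) * G y X Y)
      - (F y)⁻¹ ^ 2 * ((Module.finrank ℝ E : ℝ) - 1)
          * fderiv ℝ F y (coordGradient G F y) * G y X Y := by
  have : CompleteSpace E := FiniteDimensional.complete ℝ E
  -- The correction consists of multiples of the identity (trace `d`), of `G⁻¹ ∇²F` (trace `ΔF`) and
  -- rank-one maps. The two rank-one maps built from the Hessian each have trace `∇²F(X, Y)`, which
  -- accounts for `d - 2`; the one built from `G` alone accounts for `d - 1`.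
  have key : (curvatureEndo (fun z => (F z ^ 2)⁻¹ • G z) y X Y).toLinearMap =
      (curvatureEndo G y X Y).toLinearMap
      + (F y)⁻¹ • (coordHessian G F y X Y • LinearMap.id
          - ((coordHessian G F y).flip Y).toLinearMap.smulRight X
          + G y X Y • ((G y).inverse ∘L coordHessian G F y).toLinearMap
          - ((G y).flip Y).toLinearMap.smulRight ((G y).inverse (coordHessian G F y X)))
      + ((F y)⁻¹ ^ 2 * fderiv ℝ F y (coordGradient G F y)) •
          (((G y).flip Y).toLinearMap.smulRight X - G y X Y • LinearMap.id) := by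
    ext V
    simpa using curvatureEndo_conformal hG hi hs hF hF0 X Y V
  rw [coordRicci_apply, key, coordRicci_apply, metricTrace]
  simp only [map_add, map_sub, map_smul, LinearMap.trace_smulRight, LinearMap.trace_id,
    ContinuousLinearMap.coe_coe, ContinuousLinearMap.flip_apply, hi.self_apply_inverse, smul_eq_mul]
  ring

end Conformal

/-! ### Product with a line -/

section LineProduct

variable {E : Type*} [NormedAddCommGroup E] [NormedSpace ℝ E]

/-- The form `ε dt² + B` on `ℝ × E`. -/
def lineProdForm (ε : ℝ) (B : E →L[ℝ] E →L[ℝ] ℝ) : ℝ × E →L[ℝ] ℝ × E →L[ℝ] ℝ :=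
  pullForm (ε • ContinuousLinearMap.mul ℝ ℝ) (ContinuousLinearMap.fst ℝ ℝ E) +
    pullForm B (ContinuousLinearMap.snd ℝ ℝ E)

theorem lineProdForm_apply (ε : ℝ) (B : E →L[ℝ] E →L[ℝ] ℝ) (X Y : ℝ × E) :
    lineProdForm ε B X Y = ε * (X.1 * Y.1) + B X.2 Y.2 := rfl

theorem contDiffAt_lineProdForm (ε : ℝ) {G : E → E →L[ℝ] E →L[ℝ] ℝ} {p : ℝ × E}
    {k : WithTop ℕ∞} (hG : ContDiffAt ℝ k G p.2) :
    ContDiffAt ℝ k (fun z : ℝ × E => lineProdForm ε (G z.2)) p :=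
  contDiffAt_const.add (contDiffAt_const.clm_comp
    ((hG.comp p contDiffAt_snd).clm_comp contDiffAt_const))

theorem isInvertible_lineProdForm {ε : ℝ} (hε : ε ≠ 0) {B : E →L[ℝ] E →L[ℝ] ℝ}
    (hi : B.IsInvertible) : (lineProdForm ε B).IsInvertible := by
  -- The inverse is block diagonal: divide the `t`-component of the covector by `ε` and apply `B⁻¹`
  -- to its restriction to `E`.
  let S : (ℝ × E →L[ℝ] ℝ) →L[ℝ] ℝ × E :=
    ((ε⁻¹ • (ContinuousLinearMap.apply ℝ ℝ ((1, 0) : ℝ × E)))).prod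
      (B.inverse ∘L ContinuousLinearMap.precomp ℝ (ContinuousLinearMap.inr ℝ ℝ E))
  have hS : ∀ l, S l = (ε⁻¹ * l (1, 0), B.inverse (l ∘L ContinuousLinearMap.inr ℝ ℝ E)) :=
    fun l => rfl
  refine ContinuousLinearMap.IsInvertible.of_inverse (g := S) ?_ ?_
  · ext l v
    · simp [hS, lineProdForm_apply, hε]
    · simp [hS, lineProdForm_apply, hi.self_apply_inverse]
  · refine ContinuousLinearMap.ext fun v => ?_
    rw [ContinuousLinearMap.comp_apply, hS]
    have : lineProdForm ε B v ∘L ContinuousLinearMap.inr ℝ ℝ E = B v.2 := by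
      ext w
      simp [lineProdForm_apply]
    rw [this, hi.inverse_apply_self]
    simp [lineProdForm_apply, hε]

/-- The metric dual of a covector on the second factor. -/
theorem inverse_lineProdForm_comp_snd {ε : ℝ} (hε : ε ≠ 0) {B : E →L[ℝ] E →L[ℝ] ℝ}
    (hi : B.IsInvertible) (l : E →L[ℝ] ℝ) :
    (lineProdForm ε B).inverse (l ∘L ContinuousLinearMap.snd ℝ ℝ E) = (0, B.inverse l) := by
  rw [(isInvertible_lineProdForm hε hi).inverse_apply_eq]
  ext v <;> simp [lineProdForm_apply, hi.self_apply_inverse]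

theorem metricTrace_lineProdForm_snd [FiniteDimensional ℝ E] {ε : ℝ} (hε : ε ≠ 0)
    {B : E →L[ℝ] E →L[ℝ] ℝ} (hi : B.IsInvertible) (A : E →L[ℝ] E →L[ℝ] ℝ) :
    metricTrace (lineProdForm ε B) (pullForm A (ContinuousLinearMap.snd ℝ ℝ E)) =
      metricTrace B A := by
  have h : (((lineProdForm ε B).inverse ∘L
      pullForm A (ContinuousLinearMap.snd ℝ ℝ E)).toLinearMap : ℝ × E →ₗ[ℝ] ℝ × E) =
      LinearMap.prodMap 0 (B.inverse ∘L A).toLinearMap := by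
    refine LinearMap.ext fun v => ?_
    exact inverse_lineProdForm_comp_snd hε hi (A v.2)
  rw [metricTrace, h, LinearMap.trace_prodMap', map_zero, zero_add, metricTrace]

theorem fderiv_lineProdForm (ε : ℝ) {G : E → E →L[ℝ] E →L[ℝ] ℝ} {p : ℝ × E}
    (hG : ContDiffAt ℝ 2 G p.2) (V X Y : ℝ × E) :
    fderiv ℝ (fun z : ℝ × E => lineProdForm ε (G z.2)) p V X Y =
      fderiv ℝ G p.2 V.2 X.2 Y.2 := by
  rw [← fderiv_bilin_apply ((contDiffAt_lineProdForm ε hG).differentiableAt two_ne_zero)]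
  have hG1 := hG.differentiableAt two_ne_zero
  have h := ((((hG1.hasFDerivAt.comp p hasFDerivAt_snd).clm_apply
    (hasFDerivAt_const X.2 p)).clm_apply (hasFDerivAt_const Y.2 p)).const_add (ε * (X.1 * Y.1)))
  have h' : fderiv ℝ (fun z : ℝ × E => lineProdForm ε (G z.2) X Y) p = _ := h.fderiv
  rw [h']
  simp

theorem christoffel_lineProdForm {ε : ℝ} (hε : ε ≠ 0) {G : E → E →L[ℝ] E →L[ℝ] ℝ} {p : ℝ × E}
    (hG : ContDiffAt ℝ 2 G p.2) (hi : (G p.2).IsInvertible) (X Y : ℝ × E) :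
    christoffel (fun z : ℝ × E => lineProdForm ε (G z.2)) p X Y =
      (0, christoffel G p.2 X.2 Y.2) := by
  rw [christoffel_apply, christoffel_apply, ← inverse_lineProdForm_comp_snd hε hi]
  congr 1
  refine ContinuousLinearMap.ext fun z => ?_
  rw [ContinuousLinearMap.comp_apply, christoffelFirst_apply, christoffelFirst_apply,
    fderiv_lineProdForm ε hG, fderiv_lineProdForm ε hG, fderiv_lineProdForm ε hG]
  rfl

theorem fderiv_christoffel_lineProdForm [CompleteSpace E] {ε : ℝ} (hε : ε ≠ 0)
    {G : E → E →L[ℝ] E →L[ℝ] ℝ} {p : ℝ × E} (hG : ContDiffAt ℝ 2 G p.2)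
    (hi : (G p.2).IsInvertible) (V X Y : ℝ × E) :
    fderiv ℝ (christoffel (fun z : ℝ × E => lineProdForm ε (G z.2))) p V X Y =
      (0, fderiv ℝ (christoffel G) p.2 V.2 X.2 Y.2) := by
  rw [← fderiv_bilin_apply (differentiableAt_christoffel (contDiffAt_lineProdForm ε hG)
    (isInvertible_lineProdForm hε hi))]
  have hev : (fun z => christoffel (fun z : ℝ × E => lineProdForm ε (G z.2)) z X Y) =ᶠ[𝓝 p]
      fun z => ((0 : ℝ), christoffel G z.2 X.2 Y.2) := by
    have h := (eventually_isInvertible hG.continuousAt hi).and (hG.eventually (by simp))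
    filter_upwards [continuousAt_snd.eventually h] with z hz
    exact christoffel_lineProdForm hε hz.2 hz.1 X Y
  rw [hev.fderiv_eq]
  have h := (((differentiableAt_christoffel hG hi).hasFDerivAt.comp p hasFDerivAt_snd).clm_apply
    (hasFDerivAt_const X.2 p)).clm_apply (hasFDerivAt_const Y.2 p)
  have h' : fderiv ℝ (fun z : ℝ × E => ((0 : ℝ), christoffel G z.2 X.2 Y.2)) p = _ :=
    ((hasFDerivAt_const (0 : ℝ) p).prodMk h).fderiv
  rw [h']
  simp

/-- The curvature endomorphism is block diagonal with zero on the line, so its trace is that of the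
second factor. -/
theorem coordRicci_lineProdForm [FiniteDimensional ℝ E] {ε : ℝ} (hε : ε ≠ 0)
    {G : E → E →L[ℝ] E →L[ℝ] ℝ} {p : ℝ × E} (hG : ContDiffAt ℝ 2 G p.2)
    (hi : (G p.2).IsInvertible) (X Y : ℝ × E) :
    coordRicci (fun z : ℝ × E => lineProdForm ε (G z.2)) p X Y =
      coordRicci G p.2 X.2 Y.2 := by
  have : CompleteSpace E := FiniteDimensional.complete ℝ E
  have h : (curvatureEndo (fun z : ℝ × E => lineProdForm ε (G z.2)) p X Y).toLinearMap =
      LinearMap.prodMap 0 (curvatureEndo G p.2 X.2 Y.2).toLinearMap := by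
    refine LinearMap.ext fun V => ?_
    rw [ContinuousLinearMap.coe_coe, curvatureEndo_apply]
    simp [fderiv_christoffel_lineProdForm hε hG hi, christoffel_lineProdForm hε hG hi,
      curvatureEndo_apply]
  rw [coordRicci_apply, coordRicci_apply, h, LinearMap.trace_prodMap', map_zero, zero_add]

theorem fderiv_comp_snd {F : E → ℝ} {p : ℝ × E} (hF : DifferentiableAt ℝ F p.2) :
    fderiv ℝ (fun z : ℝ × E => F z.2) p = fderiv ℝ F p.2 ∘L ContinuousLinearMap.snd ℝ ℝ E :=
  (hF.hasFDerivAt.comp p hasFDerivAt_snd).fderiv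

theorem coordHessian_lineProdForm {ε : ℝ} (hε : ε ≠ 0)
    {G : E → E →L[ℝ] E →L[ℝ] ℝ} {p : ℝ × E} (hG : ContDiffAt ℝ 2 G p.2)
    (hi : (G p.2).IsInvertible) {F : E → ℝ} (hF : ContDiffAt ℝ 2 F p.2) :
    coordHessian (fun z : ℝ × E => lineProdForm ε (G z.2)) (fun z => F z.2) p =
      pullForm (coordHessian G F p.2) (ContinuousLinearMap.snd ℝ ℝ E) := by
  refine ContinuousLinearMap.ext fun X => ContinuousLinearMap.ext fun Y => ?_
  have hev : fderiv ℝ (fun z : ℝ × E => F z.2) =ᶠ[𝓝 p]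
      fun z => fderiv ℝ F z.2 ∘L ContinuousLinearMap.snd ℝ ℝ E := by
    filter_upwards [continuousAt_snd.eventually (hF.eventually (by simp))] with z hz
    exact fderiv_comp_snd (hz.differentiableAt two_ne_zero)
  have h := ((differentiableAt_fderiv hF).hasFDerivAt.comp p hasFDerivAt_snd).clm_comp
    (hasFDerivAt_const (ContinuousLinearMap.snd ℝ ℝ E) p)
  have h' : fderiv ℝ (fun z : ℝ × E => fderiv ℝ F z.2 ∘L ContinuousLinearMap.snd ℝ ℝ E) p = _ :=
    h.fderiv
  rw [pullForm_apply, coordHessian_apply, coordHessian_apply, hev.fderiv_eq, h',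
    christoffel_lineProdForm hε hG hi, fderiv_comp_snd (hF.differentiableAt two_ne_zero)]
  simp

/-- The Ricci tensor of `F⁻² (ε dt² + G)`, where `F` and `G` do not depend on `t`. -/
theorem coordRicci_conformal_lineProdForm [FiniteDimensional ℝ E] {ε : ℝ} (hε : ε ≠ 0)
    {G : E → E →L[ℝ] E →L[ℝ] ℝ} {p : ℝ × E} (hG : ContDiffAt ℝ 2 G p.2)
    (hi : (G p.2).IsInvertible) (hs : ∀ᶠ z in 𝓝 p.2, ∀ v w, G z v w = G z w v)
    {F : E → ℝ} (hF : ContDiffAt ℝ 2 F p.2) (hF0 : F p.2 ≠ 0) (X Y : ℝ × E) :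
    coordRicci (fun z : ℝ × E => (F z.2 ^ 2)⁻¹ • lineProdForm ε (G z.2)) p X Y =
      coordRicci G p.2 X.2 Y.2
      + (F p.2)⁻¹ * (((Module.finrank ℝ E : ℝ) - 1) * coordHessian G F p.2 X.2 Y.2
          + metricTrace (G p.2) (coordHessian G F p.2) * lineProdForm ε (G p.2) X Y)
      - (F p.2)⁻¹ ^ 2 * (Module.finrank ℝ E : ℝ)
          * fderiv ℝ F p.2 (coordGradient G F p.2) * lineProdForm ε (G p.2) X Y := by
  have hs' : ∀ᶠ z in 𝓝 p, ∀ v w, lineProdForm ε (G z.2) v w = lineProdForm ε (G z.2) w v := by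
    filter_upwards [continuousAt_snd.eventually hs] with z hz v w
    rw [lineProdForm_apply, lineProdForm_apply, hz, mul_comm v.1]
  have hgrad : coordGradient (fun z : ℝ × E => lineProdForm ε (G z.2)) (fun z => F z.2) p =
      (0, coordGradient G F p.2) := by
    rw [coordGradient, fderiv_comp_snd (hF.differentiableAt two_ne_zero),
      inverse_lineProdForm_comp_snd hε hi, coordGradient]
  rw [coordRicci_conformal (F := fun z : ℝ × E => F z.2) (contDiffAt_lineProdForm ε hG)
    (isInvertible_lineProdForm hε hi) hs' (hF.comp p contDiffAt_snd) hF0,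
    coordRicci_lineProdForm hε hG hi, coordHessian_lineProdForm hε hG hi hF, hgrad,
    metricTrace_lineProdForm_snd hε hi, fderiv_comp_snd (hF.differentiableAt two_ne_zero),
    Module.finrank_prod, Module.finrank_self, pullForm_apply]
  simp only [ContinuousLinearMap.coe_snd', ContinuousLinearMap.comp_apply]
  push_cast
  ring

end LineProduct

/-! ### From charts to tensors on the manifold -/

section Charts

variable {E : Type*} [NormedAddCommGroup E] [NormedSpace ℝ E]
  {H : Type*} [TopologicalSpace H] {I : ModelWithCorners ℝ E H}
  {M : Type*} [TopologicalSpace M] [ChartedSpace H M]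

theorem isInvertible_of_nondegenerate [FiniteDimensional ℝ E] {B : E →L[ℝ] E →L[ℝ] ℝ}
    (h : ∀ v, (∀ w, B v w = 0) → v = 0) : B.IsInvertible := by
  have hinj : Function.Injective B.toLinearMap := by
    rw [← LinearMap.ker_eq_bot, LinearMap.ker_eq_bot']
    exact fun v hv => h v fun w => congrArg (fun l : E →L[ℝ] ℝ => l w) hv
  have hd : Module.finrank ℝ E = Module.finrank ℝ (E →L[ℝ] ℝ) := by
    rw [← (LinearMap.toContinuousLinearMap (𝕜 := ℝ) (E := E) (F' := ℝ)).finrank_eq]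
    exact Subspace.dual_finrank_eq.symm
  exact ⟨(B.toLinearMap.linearEquivOfInjective hinj hd).toContinuousLinearEquiv, rfl⟩

theorem metricTrace_add (b B B' : E →L[ℝ] E →L[ℝ] ℝ) :
    metricTrace b (B + B') = metricTrace b B + metricTrace b B' := by
  rw [metricTrace, metricTrace, metricTrace, ← map_add, ContinuousLinearMap.comp_add]
  rfl

theorem metricTrace_smul (b B : E →L[ℝ] E →L[ℝ] ℝ) (c : ℝ) :
    metricTrace b (c • B) = c * metricTrace b B := by
  rw [metricTrace, metricTrace, ContinuousLinearMap.comp_smul, ← smul_eq_mul, ← map_smul]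
  rfl

theorem metricTrace_zero (b : E →L[ℝ] E →L[ℝ] ℝ) : metricTrace b 0 = 0 := by
  simpa using metricTrace_smul b 0 0

theorem metricTrace_self [FiniteDimensional ℝ E] {b : E →L[ℝ] E →L[ℝ] ℝ} (hi : b.IsInvertible) :
    metricTrace b b = Module.finrank ℝ E := by
  rw [metricTrace, hi.inverse_comp_self]
  exact LinearMap.trace_id ℝ E

theorem mfderiv_eq_fderiv_chart [I.Boundaryless] {f : M → ℝ} {x : M}
    (hf : MDifferentiableAt I 𝓘(ℝ, ℝ) f x) :
    mfderiv I 𝓘(ℝ, ℝ) f x =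
      (fderiv ℝ (f ∘ (extChartAt I x).symm) (extChartAt I x x) : E →L[ℝ] ℝ) := by
  rw [hf.mfderiv, I.range_eq_univ, fderivWithin_univ]
  rfl

variable [IsManifold I 1 M]

/-- The tangent space at `x` is identified with `E` through the chart at `x`, so the inverse chart
has derivative the identity at the centre. -/
theorem localForm_extChartAt_self [I.Boundaryless] (g : FormField I M) (x : M) :
    localForm g x (extChartAt I x x) = (g x : E →L[ℝ] E →L[ℝ] ℝ) := by
  have h := mfderivWithin_range_extChartAt_symm (I := I) (x := x)
  rw [I.range_eq_univ, mfderivWithin_univ] at h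
  -- Base point and derivative are generalized, because the inverse chart returns to `x` only
  -- propositionally and the tangent space depends on the point.
  have key : ∀ x' : M, x' = x → ∀ L : E →L[ℝ] E, L = ContinuousLinearMap.id ℝ E →
      pullForm (V := E) (W := E) (g x') L = (g x : E →L[ℝ] E →L[ℝ] ℝ) := by
    rintro x' rfl L rfl
    rfl
  exact key _ (extChartAt_to_inv x) _ h

theorem hessian_eq_coordHessian (g : FormField I M) (f : M → ℝ) (x : M) :
    hessian g f x = (coordHessian (localForm g x) (f ∘ (extChartAt I x).symm)
      (extChartAt I x x) : E →L[ℝ] E →L[ℝ] ℝ) := by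
  rw [hessian, mfderiv_extChartAt_self]
  rfl

theorem ricci_eq_coordRicci [FiniteDimensional ℝ E] (g : FormField I M) (x : M) :
    ricci g x = (coordRicci (localForm g x) (extChartAt I x x) : E →L[ℝ] E →L[ℝ] ℝ) := by
  rw [ricci, mfderiv_extChartAt_self]
  rfl

theorem gradNormSq_eq [I.Boundaryless] {g : FormField I M} {f : M → ℝ} {x : M}
    (hi : (g x : E →L[ℝ] E →L[ℝ] ℝ).IsInvertible)
    (hf : MDifferentiableAt I 𝓘(ℝ, ℝ) f x) :
    gradNormSq g f x = fderiv ℝ (f ∘ (extChartAt I x).symm) (extChartAt I x x)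
      (coordGradient (localForm g x) (f ∘ (extChartAt I x).symm) (extChartAt I x x)) := by
  rw [coordGradient, localForm_extChartAt_self, gradNormSq, gradient, mfderiv_eq_fderiv_chart hf]
  exact congrArg (fun l : E →L[ℝ] ℝ => l _) (hi.self_apply_inverse _)

/-- The chain rule for the two projections composed with the product chart. It is proved over the
whole chart target, not only at the centre, because Ricci involves derivatives of the metric. -/
theorem localForm_conformal_product [I.Boundaryless] (g : FormField I M) (φ : M → ℝ) (ε : ℝ)
    (t : ℝ) (x : M) (z : ℝ × E) (hz : z.2 ∈ (extChartAt I x).target) :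
    localForm (scaleForm (fun p : ℝ × M => (φ p.2 ^ 2)⁻¹) (productMetric (lineMetric ε) g))
      (t, x) z = (((φ ∘ (extChartAt I x).symm) z.2) ^ 2)⁻¹ •
        lineProdForm ε (localForm g x z.2) := by
  have hs : MDifferentiableAt 𝓘(ℝ, E) I (extChartAt I x).symm z.2 := by
    have := mdifferentiableWithinAt_extChartAt_symm hz
    rwa [I.range_eq_univ, mdifferentiableWithinAt_univ] at this
  have hz' : z ∈ (extChartAt (𝓘(ℝ, ℝ).prod I) (t, x)).target := by
    rw [extChartAt_prod]
    exact ⟨by rw [extChartAt_model_space_eq_id]; exact Set.mem_univ z.1, hz⟩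
  have hp : MDifferentiableAt 𝓘(ℝ, ℝ × E) (𝓘(ℝ, ℝ).prod I)
      (extChartAt (𝓘(ℝ, ℝ).prod I) ((t, x) : ℝ × M)).symm z := by
    have := mdifferentiableWithinAt_extChartAt_symm hz'
    rwa [ModelWithCorners.range_eq_univ, mdifferentiableWithinAt_univ] at this
  have e1 : (Prod.fst ∘ (extChartAt (𝓘(ℝ, ℝ).prod I) ((t, x) : ℝ × M)).symm) = Prod.fst := by
    rw [extChartAt_prod]
    rfl
  have d1 := mfderiv_comp z (I := 𝓘(ℝ, ℝ × E)) (I' := 𝓘(ℝ, ℝ).prod I) (I'' := 𝓘(ℝ, ℝ))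
    (g := Prod.fst) mdifferentiableAt_fst hp
  have d2 := mfderiv_comp z (I := 𝓘(ℝ, ℝ × E)) (I' := 𝓘(ℝ, ℝ).prod I) (I'' := I)
    (g := Prod.snd) mdifferentiableAt_snd hp
  have d3 := mfderiv_comp z (I := 𝓘(ℝ, ℝ × E)) (I' := 𝓘(ℝ, E)) (I'' := I)
    (g := (extChartAt I x).symm) (f := Prod.snd) hs
    differentiableAt_snd.mdifferentiableAt
  have k1 : ∀ v : ℝ × E, (mfderiv (𝓘(ℝ, ℝ).prod I) 𝓘(ℝ, ℝ) Prod.fst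
      ((extChartAt (𝓘(ℝ, ℝ).prod I) ((t, x) : ℝ × M)).symm z)
      (mfderiv 𝓘(ℝ, ℝ × E) (𝓘(ℝ, ℝ).prod I)
        (extChartAt (𝓘(ℝ, ℝ).prod I) ((t, x) : ℝ × M)).symm z v) : ℝ) = v.1 := by
    intro v
    have h := congrArg (fun L : ℝ × E →L[ℝ] ℝ => L v) d1
    refine h.symm.trans ?_
    have h' : mfderiv 𝓘(ℝ, ℝ × E) 𝓘(ℝ, ℝ)
        (Prod.fst ∘ (extChartAt (𝓘(ℝ, ℝ).prod I) ((t, x) : ℝ × M)).symm) z =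
        (ContinuousLinearMap.fst ℝ ℝ E : ℝ × E →L[ℝ] ℝ) := by
      rw [mfderiv_eq_fderiv, e1]
      exact fderiv_fst
    exact congrArg (fun L : ℝ × E →L[ℝ] ℝ => L v) h'
  have k2 : ∀ v : ℝ × E, (mfderiv (𝓘(ℝ, ℝ).prod I) I Prod.snd
      ((extChartAt (𝓘(ℝ, ℝ).prod I) ((t, x) : ℝ × M)).symm z)
      (mfderiv 𝓘(ℝ, ℝ × E) (𝓘(ℝ, ℝ).prod I)
        (extChartAt (𝓘(ℝ, ℝ).prod I) ((t, x) : ℝ × M)).symm z v) : E) =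
      mfderiv 𝓘(ℝ, E) I (extChartAt I x).symm z.2 v.2 := by
    intro v
    have h := congrArg (fun L : ℝ × E →L[ℝ] E => L v) d2
    have h3 := congrArg (fun L : ℝ × E →L[ℝ] E => L v) d3
    refine h.symm.trans (h3.trans ?_)
    have h' : mfderiv 𝓘(ℝ, ℝ × E) 𝓘(ℝ, E) (Prod.snd : ℝ × E → E) z =
        (ContinuousLinearMap.snd ℝ ℝ E : ℝ × E →L[ℝ] E) := by
      rw [mfderiv_eq_fderiv]
      exact fderiv_snd
    exact congrArg (fun L : ℝ × E →L[ℝ] E =>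
      (mfderiv 𝓘(ℝ, E) I (extChartAt I x).symm z.2 : E →L[ℝ] E) (L v)) h'
  refine ContinuousLinearMap.ext fun v => ContinuousLinearMap.ext fun w => ?_
  have hl := congrArg₂ (fun a b : ℝ => ε * (a * b)) (k1 v) (k1 w)
  have hr := congrArg₂ (fun a b : E =>
    (g ((extChartAt I x).symm z.2) : E →L[ℝ] E →L[ℝ] ℝ) a b) (k2 v) (k2 w)
  exact congrArg₂ (fun a b : ℝ => (φ ((extChartAt I x).symm z.2) ^ 2)⁻¹ * (a + b)) hl hr

end Charts

/-! ### The Ricci tensor of the conformal product -/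

section Product

variable {E : Type*} [NormedAddCommGroup E] [NormedSpace ℝ E]
  {H : Type*} [TopologicalSpace H] {I : ModelWithCorners ℝ E H}
  {M : Type*} [TopologicalSpace M] [ChartedSpace H M]

theorem IsPseudoRiemannianMetric.isInvertible [FiniteDimensional ℝ E] {k : WithTop ℕ∞}
    {g : FormField I M}
    (hg : IsPseudoRiemannianMetric k g) (x : M) :
    (g x : E →L[ℝ] E →L[ℝ] ℝ).IsInvertible :=
  isInvertible_of_nondegenerate (E := E) (hg.nondegenerate x)

theorem IsPseudoRiemannianMetric.contDiffAt_localForm [I.Boundaryless] {k : WithTop ℕ∞}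
    {g : FormField I M} (hg : IsPseudoRiemannianMetric k g) (x : M) :
    ContDiffAt ℝ k (localForm g x) (extChartAt I x x) :=
  (hg.contDiffOn x).contDiffAt (extChartAt_target_mem_nhds x)

theorem contDiffAt_comp_extChartAt_symm [I.Boundaryless] {k : WithTop ℕ∞} [IsManifold I k M]
    {f : M → ℝ} (hf : ContMDiff I 𝓘(ℝ, ℝ) k f) (x : M) :
    ContDiffAt ℝ k (f ∘ (extChartAt I x).symm) (extChartAt I x x) := by
  have h := (contMDiffAt_iff.1 (hf x)).2
  rw [I.range_eq_univ, contDiffWithinAt_univ] at h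
  exact h

variable [I.Boundaryless]

theorem conformal_product_apply [IsManifold I 1 M] (g : FormField I M) (φ : M → ℝ) (ε t : ℝ)
    (x : M) :
    (scaleForm (fun p : ℝ × M => (φ p.2 ^ 2)⁻¹) (productMetric (lineMetric ε) g) (t, x) :
      ℝ × E →L[ℝ] ℝ × E →L[ℝ] ℝ) = (φ x ^ 2)⁻¹ • lineProdForm (E := E) ε (g x) := by
  have h := localForm_conformal_product g φ ε t x
    (extChartAt (𝓘(ℝ, ℝ).prod I) ((t, x) : ℝ × M) (t, x)) (mem_extChartAt_target x)
  rw [localForm_extChartAt_self] at h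
  refine h.trans ?_
  have h2 : (extChartAt (𝓘(ℝ, ℝ).prod I) ((t, x) : ℝ × M) (t, x)).2 = extChartAt I x x := rfl
  rw [h2, localForm_extChartAt_self, Function.comp_apply, extChartAt_to_inv]

/-- The Ricci tensor of `φ⁻² (ε dt² + g)` on `ℝ × M`. -/
theorem ricci_conformal_product [FiniteDimensional ℝ E] [IsManifold I 2 M]
    [IsManifold I 1 M] {g : FormField I M}
    (hg : IsPseudoRiemannianMetric 2 g) {φ : M → ℝ} (hφ : ContMDiff I 𝓘(ℝ, ℝ) 2 φ)
    {ε : ℝ} (hε : ε ≠ 0) (t : ℝ) {x : M} (hφ0 : φ x ≠ 0) (X Y : ℝ × E) :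
    (ricci (scaleForm (fun p : ℝ × M => (φ p.2 ^ 2)⁻¹) (productMetric (lineMetric ε) g)) (t, x) :
      ℝ × E →L[ℝ] ℝ × E →L[ℝ] ℝ) X Y =
      (ricci g x : E →L[ℝ] E →L[ℝ] ℝ) X.2 Y.2
      + (φ x)⁻¹ * (((Module.finrank ℝ E : ℝ) - 1) *
            (hessian g φ x : E →L[ℝ] E →L[ℝ] ℝ) X.2 Y.2
          + laplacian g φ x * (ε * (X.1 * Y.1) + (g x : E →L[ℝ] E →L[ℝ] ℝ) X.2 Y.2))
      - (φ x)⁻¹ ^ 2 * (Module.finrank ℝ E : ℝ) * gradNormSq g φ x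
          * (ε * (X.1 * Y.1) + (g x : E →L[ℝ] E →L[ℝ] ℝ) X.2 Y.2) := by
  have hi : (localForm g x (extChartAt I x x)).IsInvertible := by
    rw [localForm_extChartAt_self]
    exact hg.isInvertible x
  have hs : ∀ᶠ z in 𝓝 (extChartAt I x x), ∀ v w, localForm g x z v w = localForm g x z w v :=
    Eventually.of_forall fun z v w => hg.symm _ _ _
  have hφx : (φ ∘ (extChartAt I x).symm) (extChartAt I x x) = φ x := by
    rw [Function.comp_apply, extChartAt_to_inv]
  have key := coordRicci_conformal_lineProdForm hε
    (p := extChartAt (𝓘(ℝ, ℝ).prod I) ((t, x) : ℝ × M) (t, x))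
    (hg.contDiffAt_localForm x) hi hs (contDiffAt_comp_extChartAt_symm hφ x)
    (hφx.trans_ne hφ0) X Y
  have hev : localForm (scaleForm (fun p : ℝ × M => (φ p.2 ^ 2)⁻¹)
      (productMetric (lineMetric ε) g)) (t, x)
      =ᶠ[𝓝 (extChartAt (𝓘(ℝ, ℝ).prod I) ((t, x) : ℝ × M) (t, x))]
      fun z : ℝ × E => (((φ ∘ (extChartAt I x).symm) z.2) ^ 2)⁻¹ •
        lineProdForm ε (localForm g x z.2) := by
    have h : Tendsto Prod.snd (𝓝 (extChartAt (𝓘(ℝ, ℝ).prod I) ((t, x) : ℝ × M) (t, x)))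
        (𝓝 (extChartAt I x x)) := continuous_snd.continuousAt
    filter_upwards [h (extChartAt_target_mem_nhds x)] with z hz
    exact localForm_conformal_product g φ ε t x z hz
  have h2 : (extChartAt (𝓘(ℝ, ℝ).prod I) ((t, x) : ℝ × M) (t, x)).2 = extChartAt I x x := rfl
  rw [h2, hφx] at key
  rw [ricci_eq_coordRicci, coordRicci_congr hev]
  refine key.trans ?_
  rw [gradNormSq_eq (hg.isInvertible x) (hφ.mdifferentiable two_ne_zero x), laplacian,
    hessian_eq_coordHessian, ricci_eq_coordRicci, localForm_extChartAt_self]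
  rfl

end Product

/-- The Einstein equation `R = lam • B'` at a point, for `B' = ψ (ε dt² + B)` and a Ricci tensor of
the form `R = c T + μ B'` with `T` a form on the second factor. -/
theorem eq_smul_iff_of_line_product {E : Type*} [NormedAddCommGroup E] [NormedSpace ℝ E]
    {T B : E →L[ℝ] E →L[ℝ] ℝ} {R B' : ℝ × E →L[ℝ] ℝ × E →L[ℝ] ℝ} {c ψ ε μ lam : ℝ}
    (hc : c ≠ 0) (hψ : ψ ≠ 0) (hε : ε ≠ 0)
    (hR : ∀ X Y, R X Y = c * T X.2 Y.2 + μ * B' X Y)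
    (hB : ∀ X Y, B' X Y = ψ * (ε * (X.1 * Y.1) + B X.2 Y.2)) :
    R = lam • B' ↔ T = 0 ∧ μ = lam := by
  constructor
  · intro h
    have h' : ∀ X Y, c * T X.2 Y.2 + μ * B' X Y = lam * B' X Y := fun X Y => by
      rw [← hR, h, smul_apply, smul_apply, smul_eq_mul]
    -- Evaluating on `(∂_t, ∂_t)` kills `T` and leaves a nonzero multiple of `μ = lam`.
    have hμ : μ = lam := by
      have h1 := h' (1, 0) (1, 0)
      rw [hB] at h1
      simpa [hψ, hε] using h1
    refine ⟨?_, hμ⟩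
    ext v w
    have h1 := h' (0, v) (0, w)
    rw [hμ] at h1
    simpa [hc] using h1
  · rintro ⟨rfl, rfl⟩
    refine ContinuousLinearMap.ext fun X => ContinuousLinearMap.ext fun Y => ?_
    rw [hR]
    simp

end PseudoRiem

end

/-! ### The Einstein condition -/

open PseudoRiem in
theorem mainTheorem6 (n : ℕ) (hn : 2 ≤ n)
    {M : Type*} [TopologicalSpace M] [ChartedSpace (EuclideanSpace ℝ (Fin n)) M]
    [IsManifold (𝓡 n) 3 M]
    (g : PseudoRiem.FormField (𝓡 n) M) (hg : PseudoRiem.IsPseudoRiemannianMetric 2 g)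
    (φ : M → ℝ) (hφ : ContMDiff (𝓡 n) 𝓘(ℝ, ℝ) 2 φ) (hφ0 : ∀ x, φ x ≠ 0)
    (ε : ℝ) (hε : ε = 1 ∨ ε = -1)
    (gbar : PseudoRiem.FormField (𝓘(ℝ, ℝ).prod (𝓡 n)) (ℝ × M))
    (hgbar : gbar = PseudoRiem.scaleForm (fun p : ℝ × M => (φ p.2 ^ 2)⁻¹)
      (PseudoRiem.productMetric (PseudoRiem.lineMetric ε) g)) :
    -- the Einstein condition is equivalent to the two equations
    (PseudoRiem.IsEinstein gbar ↔
      (∀ x : M, φ x • PseudoRiem.ricci g x + ((n : ℝ) - 1) • PseudoRiem.hessian g φ x = 0) ∧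
      ∃ kbar : ℝ, ∀ x : M, PseudoRiem.gradNormSq g φ x
        + φ x ^ 2 * PseudoRiem.normalizedScalarCurvature g x + kbar = 0) ∧
    -- and the constant in the second one is the normalized scalar curvature of `gbar`
    (PseudoRiem.IsEinstein gbar → ∀ (t : ℝ) (x : M), PseudoRiem.gradNormSq g φ x
        + φ x ^ 2 * PseudoRiem.normalizedScalarCurvature g x
        + PseudoRiem.normalizedScalarCurvature gbar (t, x) = 0) ∧
    -- the trace of the left-hand side of the first equation
    (∀ x : M, PseudoRiem.metricTrace (g x)
        (φ x • PseudoRiem.ricci g x + ((n : ℝ) - 1) • PseudoRiem.hessian g φ x) =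
      φ x * PseudoRiem.scalarCurvature g x + ((n : ℝ) - 1) * PseudoRiem.laplacian g φ x) ∧
    -- so that the first equation implies the trace equation
    ((∀ x : M, φ x • PseudoRiem.ricci g x + ((n : ℝ) - 1) • PseudoRiem.hessian g φ x = 0) →
      ∀ x : M, φ x * PseudoRiem.scalarCurvature g x
        + ((n : ℝ) - 1) * PseudoRiem.laplacian g φ x = 0) := by
  have : IsManifold (𝓡 n) 2 M := IsManifold.of_le (n := 3) (by norm_num)
  have : IsManifold (𝓡 n) 1 M := IsManifold.of_le (n := 3) (by norm_num)
  have hε0 : ε ≠ 0 := by rcases hε with rfl | rfl <;> norm_num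
  have hn0 : (n : ℝ) ≠ 0 := Nat.cast_ne_zero.2 (by omega)
  have hn1 : (n : ℝ) - 1 ≠ 0 := by
    have : (2 : ℝ) ≤ n := by exact_mod_cast hn
    intro h
    linarith
  have hfr : Module.finrank ℝ (EuclideanSpace ℝ (Fin n)) = n := finrank_euclideanSpace_fin
  have htr : ∀ x : M, metricTrace (g x) (φ x • ricci g x + ((n : ℝ) - 1) • hessian g φ x) =
      φ x * scalarCurvature g x + ((n : ℝ) - 1) * laplacian g φ x := fun x =>
    (metricTrace_add (E := EuclideanSpace ℝ (Fin n)) _ _ _).trans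
      (congrArg₂ (· + ·) (metricTrace_smul (E := EuclideanSpace ℝ (Fin n)) _ _ _)
        (metricTrace_smul (E := EuclideanSpace ℝ (Fin n)) _ _ _))
  have htr0 : (∀ x : M, φ x • ricci g x + ((n : ℝ) - 1) • hessian g φ x = 0) →
      ∀ x : M, φ x * scalarCurvature g x + ((n : ℝ) - 1) * laplacian g φ x = 0 := by
    intro h x
    rw [← htr, h x]
    exact metricTrace_zero (E := EuclideanSpace ℝ (Fin n)) (g x)
  have hval : ∀ (t : ℝ) (x : M) (X Y : ℝ × EuclideanSpace ℝ (Fin n)),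
      (gbar (t, x) : ℝ × EuclideanSpace ℝ (Fin n) →L[ℝ] _ →L[ℝ] ℝ) X Y =
        (φ x ^ 2)⁻¹ * (ε * (X.1 * Y.1) +
          (g x : EuclideanSpace ℝ (Fin n) →L[ℝ] _ →L[ℝ] ℝ) X.2 Y.2) := by
    intro t x X Y
    rw [hgbar, conformal_product_apply]
    rfl
  have hric : ∀ (t : ℝ) (x : M) (X Y : ℝ × EuclideanSpace ℝ (Fin n)),
      (ricci gbar (t, x) : ℝ × EuclideanSpace ℝ (Fin n) →L[ℝ] _ →L[ℝ] ℝ) X Y =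
        (φ x)⁻¹ * (φ x • ricci g x + ((n : ℝ) - 1) • hessian g φ x :
          EuclideanSpace ℝ (Fin n) →L[ℝ] _ →L[ℝ] ℝ) X.2 Y.2 +
        (φ x * laplacian g φ x - n * gradNormSq g φ x) *
        (gbar (t, x) : ℝ × EuclideanSpace ℝ (Fin n) →L[ℝ] _ →L[ℝ] ℝ) X Y := by
    intro t x X Y
    rw [hval]
    have h := ricci_conformal_product hg hφ hε0 t (hφ0 x) X Y
    rw [← hgbar, hfr] at h
    have alg : ∀ r s l p q c : ℝ, c ≠ 0 →
        r + c⁻¹ * ((n - 1) * s + l * p) - c⁻¹ ^ 2 * n * q * p =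
          c⁻¹ * (c * r + (n - 1) * s) + (c * l - n * q) * ((c ^ 2)⁻¹ * p) := by
      intro r s l p q c hc
      field_simp
      ring
    exact h.trans (alg _ _ _ _ _ _ (hφ0 x))
  -- the Einstein equation with constant `lam`
  have hEin : ∀ lam : ℝ, (∀ p, ricci gbar p = lam • gbar p) ↔
      (∀ x : M, φ x • ricci g x + ((n : ℝ) - 1) • hessian g φ x = 0) ∧
      ∀ x, φ x * laplacian g φ x - n * gradNormSq g φ x = lam := by
    intro lam
    have hpt : ∀ (t : ℝ) (x : M), ricci gbar (t, x) = lam • gbar (t, x) ↔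
        φ x • ricci g x + ((n : ℝ) - 1) • hessian g φ x = 0 ∧
        φ x * laplacian g φ x - n * gradNormSq g φ x = lam := fun t x =>
      eq_smul_iff_of_line_product (E := EuclideanSpace ℝ (Fin n)) (inv_ne_zero (hφ0 x))
        (inv_ne_zero (pow_ne_zero 2 (hφ0 x))) hε0 (hric t x) (hval t x)
    -- Neither equation involves `t`, so the slice `t = 0` suffices for this direction.
    exact ⟨fun h => ⟨fun x => ((hpt 0 x).1 (h (0, x))).1, fun x => ((hpt 0 x).1 (h (0, x))).2⟩,
      fun h p => (hpt p.1 p.2).2 ⟨h.1 p.2, h.2 p.2⟩⟩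
  -- the value of the second expression under the first equation
  have hsec : (∀ x : M, φ x • ricci g x + ((n : ℝ) - 1) • hessian g φ x = 0) → ∀ x,
      φ x * laplacian g φ x - n * gradNormSq g φ x =
        -(n * (gradNormSq g φ x + φ x ^ 2 * normalizedScalarCurvature g x)) := by
    intro h x
    -- The traced first equation, solved for `Δφ`; then `φ Δφ = -n φ² k` by the normalization `k = S
    -- / (n (n - 1))`.
    have h1 : laplacian g φ x = -(φ x * scalarCurvature g x) / ((n : ℝ) - 1) := by
      rw [eq_div_iff hn1]
      linarith [htr0 h x]
    rw [normalizedScalarCurvature, hfr, h1]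
    field_simp
    ring
  refine ⟨⟨?_, ?_⟩, ?_, htr, htr0⟩
  · rintro ⟨lam, h⟩
    obtain ⟨h1, h2⟩ := (hEin lam).1 h
    refine ⟨h1, lam / n, fun x => ?_⟩
    rw [← h2 x, hsec h1 x]
    field_simp
    ring
  · rintro ⟨h1, k, h2⟩
    refine ⟨n * k, (hEin _).2 ⟨h1, fun x => ?_⟩⟩
    rw [hsec h1 x, eq_neg_of_add_eq_zero_left (h2 x)]
    ring
  · rintro ⟨lam, h⟩ t x
    obtain ⟨h1, h2⟩ := (hEin lam).1 h
    have hi : (gbar (t, x) : ℝ × EuclideanSpace ℝ (Fin n) →L[ℝ] _ →L[ℝ] ℝ).IsInvertible := by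
      rw [hgbar, conformal_product_apply]
      exact isInvertible_smul (E := ℝ × EuclideanSpace ℝ (Fin n))
        (inv_ne_zero (pow_ne_zero 2 (hφ0 x)))
        (isInvertible_lineProdForm hε0 (hg.isInvertible x))
    have hfr' : Module.finrank ℝ (ℝ × EuclideanSpace ℝ (Fin n)) = n + 1 := by
      rw [Module.finrank_prod, Module.finrank_self, hfr, add_comm]
    -- The trace of `lam • gbar` is `lam` times the dimension `n + 1`, so normalizing by `(n + 1) n`
    -- leaves `lam / n`.
    have hS : scalarCurvature gbar (t, x) = lam * (n + 1) := by
      rw [scalarCurvature, h (t, x)]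
      refine (metricTrace_smul (E := ℝ × EuclideanSpace ℝ (Fin n)) _ _ _).trans ?_
      refine congrArg (lam * ·) ((metricTrace_self hi).trans ?_)
      rw [hfr']
      push_cast
      ring
    have hn2 : (n : ℝ) + 1 ≠ 0 := by positivity
    have h3 : normalizedScalarCurvature gbar (t, x) = lam / n := by
      rw [normalizedScalarCurvature, hS, hfr']
      push_cast
      rw [add_sub_cancel_right]
      field_simp
    rw [h3, ← h2 x, hsec h1 x]
    field_simp
    ring
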